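/- Let $m$ be Lebesgue measure on the Borel sets of $[0,1]$. A map $T:[0,1]\to[0,1]$ is non-singular if it is measurable and $T_\star m\ll m$; its transfer operator $P_T:L^1(m)\to L^1(m)$ is defined by $\int (P_Tf)\,g\,dm=\int f\cdot (g\circ T)\,dm$ for all $f\in L^1(m)$, $g\in L^\infty(m)$. For $f\in L^1(m)$ let $\mathrm V f$ be the infimum of the total variations over $[0,1]$ of the functions equal to $f$ $m$-a.e., let $\mathrm{BV}=\{f\in L^1(m):\mathrm Vf<\infty\}$ and $\|f\|_{\mathrm{BV}}=\mathrm Vf+\|f\|_{L^1_m}$. Let $\mathcal C$ be a class of non-singular maps of $[0,1]$ and $\mathcal P=\{P_T:T\in\mathcal C\}$. Suppose that the following conditions hold. $(D_r)$: every $P\in\mathcal P$ leaves $\mathrm{BV}$ invariant, and for some integer $r\ge1$ and constants $0<\rho_r<1$, $M_0,C_r>0$ one has $\|Pf\|_{\mathrm{BV}}\le M_0\|f\|_{\mathrm{BV}}$ and $\|P_r\cdots P_1f\|_{\mathrm{BV}}\le\rho_r\|f\|_{\mathrm{BV}}+C_r\|f\|_{L^1_m}$ for all $P,P_1,\dots,P_r\in\mathcal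 P$ and $f\in\mathrm{BV}$. (Dec): there are $\theta<1$ and $K>0$ such that $\|P_l\cdots P_1f\|_{\mathrm{BV}}\le K\theta^l\|f\|_{\mathrm{BV}}$ for all $l\ge1$, all $P_1,\dots,P_l\in\mathcal P$ and all $f\in\mathrm{BV}$ with $\int f\,dm=0$. Let $(T_n)_{n\ge1}$ be a sequence of maps in $\mathcal C$, and put $T_1^0=\mathrm{id}$, $T_1^n=T_n\circ\cdots\circ T_1$. Suppose moreover that the following condition holds. (Min): there is $\delta>0$ such that $P_{T_1^n}\mathbf 1\ge\delta$ $m$-a.e. for all $n\ge1$. For $n\ge1$ and $x\in[0,1]$ let $\mathcal E_n(x)=\frac1n\sum_{k=0}^{n-1}\delta_{T_1^kx}$ and $m_n=\frac1n\sum_{k=0}^{n-1}(T_1^k)_\star m$, and for probability measures $\mu_1,\mu_2$ on $[0,1]$ let $\kappa(\mu_1,\mu_2)=\int_0^1|\mu_1([0,t])-\mu_2([0,t])|\,dt$ be their Kantorovich distance. Then there exists $C>0$ such that for all $t>0$ and all $n\ge1$ $$m\Big(\Big\{x\in[0,1]:\kappa(\mathcal E_n(x),m_n)>\frac{t}{\sqrt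 n}\Big\}\Big)\le 2e^{-Ct^2}.$$ -/

import Mathlib

open MeasureTheory
open scoped unitInterval ENNReal

namespace SeqDyn

noncomputable section

/-- The space `L¹(m)`, with `m` the Lebesgue measure on `X = [0,1]`. -/
abbrev L1 : Type := Lp ℝ 1 (volume : Measure I)

/-- A class of non-singular transformations of `([0,1], m)`: every `T` in the class is measurable
and satisfies `T_* m ≪ m`. -/
def NonsingularClass (𝒞 : Set (I → I)) : Prop :=
  ∀ T ∈ 𝒞, Measure.QuasiMeasurePreserving T (volume : Measure I) volume

/-- The transfer operator of `T`: `P_T f` is the Radon-Nikodym derivative with respect to `m` of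
the image under `T` of the signed measure `f dm`. -/
def transferOp (T : I → I) (f : L1) : L1 :=
  (SignedMeasure.integrable_rnDeriv
    (((volume : Measure I).withDensityᵥ f).map T) (volume : Measure I)).toL1 _

/-- `P_T f` is characterised by `∫_A P_T f dm = ∫_{T⁻¹ A} f dm` for all Borel sets `A`. -/
theorem setIntegral_transferOp {T : I → I}
    (hT : Measure.QuasiMeasurePreserving T (volume : Measure I) volume) (f : L1)
    {A : Set I} (hA : MeasurableSet A) :
    ∫ x in A, transferOp T f x = ∫ x in T ⁻¹' A, f x := by
  have hf : Integrable (f : I → ℝ) (volume : Measure I) := L1.integrable_coeFn f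
  set s : SignedMeasure I := ((volume : Measure I).withDensityᵥ f).map T with hs
  have hsA : ∀ B : Set I, MeasurableSet B → s B = ∫ x in T ⁻¹' B, f x := by
    intro B hB
    rw [hs, VectorMeasure.map_apply _ hT.measurable hB,
      withDensityᵥ_apply hf (hT.measurable hB)]
  have hac : s ≪ᵥ (volume : Measure I).toENNRealVectorMeasure := by
    refine VectorMeasure.AbsolutelyContinuous.mk fun B hB h0 => ?_
    rw [Measure.toENNRealVectorMeasure_apply_measurable hB] at h0
    rw [hsA B hB]
    exact setIntegral_measure_zero _ (hT.preimage_null h0)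
  have hrn := (SignedMeasure.absolutelyContinuous_iff_withDensityᵥ_rnDeriv_eq s volume).1 hac
  have h1 : ∫ x in A, transferOp T f x = ∫ x in A, s.rnDeriv volume x :=
    setIntegral_congr_ae hA ((Integrable.coeFn_toL1 _).mono fun x hx _ => hx)
  rw [h1, ← hsA A hA, ← withDensityᵥ_apply (SignedMeasure.integrable_rnDeriv s volume) hA, hrn]

/-- `V f`, the infimum of the total variations on `[0,1]` of the representatives of `f`. -/
def essVar (f : L1) : ℝ≥0∞ :=
  ⨅ (g : I → ℝ) (_ : g =ᵐ[volume] f), eVariationOn g Set.univ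

/-- `f` belongs to the space `BV`. -/
def IsBV (f : L1) : Prop := essVar f ≠ ∞

/-- The norm `‖f‖_BV = V f + ‖f‖_{L¹}` of a function `f` in `BV`. -/
def bvNorm (f : L1) : ℝ := (essVar f).toReal + ‖f‖

/-- `P_l ⋯ P_1 f`, for the tuple of operators `[P_1, …, P_l]`. -/
def applyOps (Ps : List (L1 → L1)) (f : L1) : L1 := Ps.foldl (fun g P => P g) f

/-- Condition (H3) with the integer `r ≥ 1`, for a set `𝓟` of operators on `L¹(m)` leaving `BV`
invariant. -/
def H3 (r : ℕ) (𝓟 : Set (L1 → L1)) : Prop :=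
  1 ≤ r ∧
  (∀ P ∈ 𝓟, ∀ f : L1, IsBV f → IsBV (P f)) ∧
  ∃ ρ M₀ C : ℝ, 0 < ρ ∧ ρ < 1 ∧ 0 < M₀ ∧ 0 < C ∧
    (∀ P ∈ 𝓟, ∀ f : L1, IsBV f → bvNorm (P f) ≤ M₀ * bvNorm f) ∧
    (∀ Ps : List (L1 → L1), Ps.length = r → (∀ P ∈ Ps, P ∈ 𝓟) →
      ∀ f : L1, IsBV f → bvNorm (applyOps Ps f) ≤ ρ * bvNorm f + C * ‖f‖)

/-- The decorrelation property of a set `𝓟` of operators, on the space of functions in `BV` with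
zero average. -/
def Decorrelation (𝓟 : Set (L1 → L1)) : Prop :=
  ∃ θ K : ℝ, θ < 1 ∧ 0 < K ∧
    ∀ l : ℕ, 1 ≤ l → ∀ Ps : List (L1 → L1), Ps.length = l → (∀ P ∈ Ps, P ∈ 𝓟) →
      ∀ f : L1, IsBV f → ∫ x, f x = 0 →
        IsBV (applyOps Ps f) ∧ bvNorm (applyOps Ps f) ≤ K * θ ^ l * bvNorm f

/-- Condition `(D_r)` for a class of maps. -/
def CondD (r : ℕ) (𝒞 : Set (I → I)) : Prop := H3 r (transferOp '' 𝒞)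

/-- Condition (Dec) for a class of maps. -/
def CondDec (𝒞 : Set (I → I)) : Prop := Decorrelation (transferOp '' 𝒞)

/-- `T_1^k = T_k ∘ ⋯ ∘ T_1`, with `T_1^0 = id`. The term `T 0` is not used. -/
def seqComp (T : ℕ → I → I) : ℕ → I → I
  | 0 => id
  | k + 1 => T (k + 1) ∘ seqComp T k

/-- Condition (Min): there is `δ > 0` such that `P_1^n 𝟙 ≥ δ` for all `n ≥ 1`. -/
def CondMin (T : ℕ → I → I) : Prop :=
  ∃ δ : ℝ, 0 < δ ∧ ∀ n : ℕ, 1 ≤ n →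
    ∀ᵐ x : I, δ ≤ transferOp (seqComp T n) (Lp.const 1 (volume : Measure I) (1 : ℝ)) x

/-- The empirical measure `(1/n) ∑_{k<n} δ_{T_1^k x}`. -/
def empiricalMeasure (T : ℕ → I → I) (n : ℕ) (x : I) : Measure I :=
  (n : ℝ≥0∞)⁻¹ • ∑ k ∈ Finset.range n, Measure.dirac (seqComp T k x)

/-- The measure `m_n = (1/n) ∑_{k<n} (T_1^k)_* m`. -/
def meanMeasure (T : ℕ → I → I) (n : ℕ) : Measure I :=
  (n : ℝ≥0∞)⁻¹ • ∑ k ∈ Finset.range n, (volume : Measure I).map (seqComp T k)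

/-- The Kantorovich distance `∫_0^1 |F_{μ₁}(t) - F_{μ₂}(t)| dt` of two probability measures on
`[0,1]`, where `F_μ(t) = μ([0,t])`. -/
def kantorovich (μ₁ μ₂ : Measure I) : ℝ :=
  ∫ t : I, |μ₁.real (Set.Iic t) - μ₂.real (Set.Iic t)|

end

end SeqDyn

/-! For a threshold `t`, let `φ k` be the indicator of `[0,t]` minus its mean under the law of
`T_1^k`, and let `h_k = P_1^k 𝟙`. Then `n κ(E_n, m_n)` is the integral over `t` of `|∑_{k<n} φ k ∘
T_1^k|`, so a sub-Gaussian bound on these sums, uniform in `t`, is enough: Jensen and Fubini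
transfer it to the integral without a union over thresholds, and Chernoff's inequality concludes.

The bound for fixed `t` comes from a reverse martingale (`exists_isReverseMartingaleDecomp`). Put
`f_k = φ k * h_k`, `G_p = ∑_{j<p} P_p ⋯ P_{j+1} f_j` and `ψ p = G_p / h_p`. Since `G_{p+1} =
P_{p+1}(f_p + G_p)`, duality says that `ψ (k+1) ∘ T_1^(k+1)` is the conditional expectation of `(φ k
+ ψ k) ∘ T_1^k` given `T_1^(k+1)`. The differences telescope to the sum up to a boundary term, and
Azuma-Hoeffding applies once they are bounded.

All three conditions serve this boundedness. `(D_r)` bounds `h_k` in `BV`, hence also `f_k`, because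
`φ k` is antitone with values in `[-1,1]` whatever `t` is. As `∫ f_k = 0`, (Dec) makes `G_p` a sum
dominated by a geometric series in `BV`, hence in sup norm. (Min) permits the division by `h_p`. -/

namespace SeqDyn

/-! ### Duality for the transfer operator. -/

section TransferOperator

variable {T : I → I}

/-- The duality `∫ (P_T f) g dm = ∫ f (g ∘ T) dm` for simple functions `g`. -/
theorem integral_transferOp_mul_simpleFunc
    (hT : Measure.QuasiMeasurePreserving T (volume : Measure I) volume) (f : L1)
    (g : SimpleFunc I ℝ) :
    ∫ x, transferOp T f x * g x = ∫ x, f x * g (T x) := by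
  have hbdd (u : L1) (g : SimpleFunc I ℝ) : Integrable (fun x => u x * g x) volume := by
    obtain ⟨c, hc⟩ := g.exists_forall_norm_le
    exact (L1.integrable_coeFn u).mul_bdd (c := c) g.measurable.aestronglyMeasurable
      (Filter.Eventually.of_forall hc)
  have hbddT (u : L1) (g : SimpleFunc I ℝ) : Integrable (fun x => u x * g (T x)) volume := by
    obtain ⟨c, hc⟩ := g.exists_forall_norm_le
    exact (L1.integrable_coeFn u).mul_bdd (c := c)
      (g.measurable.comp hT.measurable).aestronglyMeasurable
      (Filter.Eventually.of_forall fun x => hc (T x))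
  induction g using SimpleFunc.induction with
  | const c hs =>
    rename_i s
    have h := setIntegral_transferOp hT f hs
    rw [← integral_indicator hs, ← integral_indicator (hT.measurable hs)] at h
    have e1 : (fun x => transferOp T f x * (SimpleFunc.piecewise s hs (SimpleFunc.const I c)
        (SimpleFunc.const I 0)) x) = fun x => s.indicator (fun x => transferOp T f x) x * c := by
      ext x
      by_cases hx : x ∈ s <;> simp [hx]
    have e2 : (fun x => f x * (SimpleFunc.piecewise s hs (SimpleFunc.const I c)
        (SimpleFunc.const I 0)) (T x)) = fun x => (T ⁻¹' s).indicator (fun x => f x) x * c := by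
      ext x
      by_cases hx : T x ∈ s <;> simp [hx]
    rw [e1, e2, integral_mul_const, integral_mul_const, h]
  | add _ hg₁ hg₂ =>
    simp only [SimpleFunc.coe_add, Pi.add_apply, mul_add]
    rw [integral_add (hbdd _ _) (hbdd _ _), integral_add (hbddT _ _) (hbddT _ _), hg₁, hg₂]

/-- The duality `∫ (P_T f) g dm = ∫ f (g ∘ T) dm` for bounded measurable functions `g`. -/
theorem integral_transferOp_mul
    (hT : Measure.QuasiMeasurePreserving T (volume : Measure I) volume) (f : L1)
    {g : I → ℝ} (hg : Measurable g) {c : ℝ} (hc : ∀ x, |g x| ≤ c) :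
    ∫ x, transferOp T f x * g x = ∫ x, f x * g (T x) := by
  have hs := hg.stronglyMeasurable
  have hc0 : 0 ≤ c := (abs_nonneg _).trans (hc 0)
  have h1 : Filter.Tendsto (fun n => ∫ x, transferOp T f x * hs.approxBounded c n x) Filter.atTop
      (nhds (∫ x, transferOp T f x * g x)) := by
    refine tendsto_integral_of_dominated_convergence (fun x => ‖transferOp T f x‖ * c)
      (fun n => (Lp.aestronglyMeasurable _).mul (SimpleFunc.aestronglyMeasurable _))
      ((L1.integrable_coeFn _).norm.mul_const c)
      (fun n => Filter.Eventually.of_forall fun x => ?_)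
      (Filter.Eventually.of_forall fun x =>
        (hs.tendsto_approxBounded_of_norm_le (hc x)).const_mul _)
    rw [norm_mul]
    gcongr
    exact hs.norm_approxBounded_le hc0 n x
  have h2 : Filter.Tendsto (fun n => ∫ x, f x * hs.approxBounded c n (T x)) Filter.atTop
      (nhds (∫ x, f x * g (T x))) := by
    refine tendsto_integral_of_dominated_convergence (fun x => ‖f x‖ * c)
      (fun n => (Lp.aestronglyMeasurable _).mul
        ((SimpleFunc.measurable _).comp hT.measurable).aestronglyMeasurable)
      ((L1.integrable_coeFn _).norm.mul_const c)
      (fun n => Filter.Eventually.of_forall fun x => ?_)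
      (Filter.Eventually.of_forall fun x =>
        (hs.tendsto_approxBounded_of_norm_le (hc (T x))).const_mul _)
    rw [norm_mul]
    gcongr
    exact hs.norm_approxBounded_le hc0 n (T x)
  simp only [integral_transferOp_mul_simpleFunc hT] at h1
  exact tendsto_nhds_unique h1 h2

theorem integral_transferOp
    (hT : Measure.QuasiMeasurePreserving T (volume : Measure I) volume) (f : L1) :
    ∫ x, transferOp T f x = ∫ x, f x := by
  simpa using setIntegral_transferOp hT f MeasurableSet.univ

end TransferOperator

/-! ### Reverse martingale differences and the Azuma-Hoeffding inequality. -/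

section ReverseMartingale

variable {T : ℕ → I → I}

theorem measurable_seqComp (hT : ∀ n, 1 ≤ n → Measurable (T n)) (k : ℕ) :
    Measurable (seqComp T k) := by
  induction k with
  | zero => exact measurable_id
  | succ k ih => exact (hT (k + 1) (by omega)).comp ih

theorem integrable_of_abs_le {u : I → ℝ} (hu : Measurable u) {c : ℝ} (hc : ∀ x, |u x| ≤ c) :
    Integrable u (volume : Measure I) :=
  Integrable.of_bound hu.aestronglyMeasurable c (Filter.Eventually.of_forall hc)

/-- Functions `φ k` and `ψ k` on `[0,1]`, bounded by constants, such that
`φ k ∘ T_1^k + ψ k ∘ T_1^k - ψ (k+1) ∘ T_1^(k+1)` is a sequence of bounded reverse martingale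
differences for the decreasing filtration generated by the maps `T_1^k`. -/
structure IsReverseMartingaleDecomp (T : ℕ → I → I) (D : ℝ) (φ ψ : ℕ → I → ℝ) : Prop where
  measurable_left : ∀ k, Measurable (φ k)
  measurable_right : ∀ k, Measurable (ψ k)
  abs_right_le : ∀ k x, |ψ k x| ≤ D
  abs_diff_le : ∀ k x y, |φ k x + ψ k x - ψ (k + 1) y| ≤ D
  -- The conditional expectation identity, tested against bounded functions of `T_1^(k+1)`; no
  -- σ-algebra is needed.
  integral_eq : ∀ k (W : I → ℝ) (c : ℝ), Measurable W → (∀ x, |W x| ≤ c) →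
    ∫ x, (φ k (seqComp T k x) + ψ k (seqComp T k x)) * W (seqComp T (k + 1) x) =
      ∫ x, ψ (k + 1) (seqComp T (k + 1) x) * W (seqComp T (k + 1) x)
  right_zero : ∀ x, ψ 0 x = 0
  integral_left : ∀ k, ∫ x, φ k (seqComp T k x) = 0

namespace IsReverseMartingaleDecomp

variable {D : ℝ} {φ ψ : ℕ → I → ℝ}

theorem abs_left_le (h : IsReverseMartingaleDecomp T D φ ψ) (k : ℕ) (x : I) :
    |φ k x| ≤ 3 * D := by
  have h1 := abs_le.1 (h.abs_right_le k x)
  have h2 := abs_le.1 (h.abs_right_le (k + 1) x)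
  have h3 := abs_le.1 (h.abs_diff_le k x x)
  rw [abs_le]
  constructor <;> linarith

theorem integral_right (h : IsReverseMartingaleDecomp T D φ ψ)
    (hT : ∀ n, 1 ≤ n → Measurable (T n)) (k : ℕ) : ∫ x, ψ k (seqComp T k x) = 0 := by
  induction k with
  | zero => simp [h.right_zero]
  | succ k ih =>
    have := h.integral_eq k (fun _ => 1) 1 measurable_const (by simp)
    simp only [mul_one] at this
    rw [← this, integral_add, ih, h.integral_left k, add_zero]
    · exact integrable_of_abs_le ((h.measurable_left k).comp (measurable_seqComp hT k))
        fun x => h.abs_left_le k _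
    · exact integrable_of_abs_le ((h.measurable_right k).comp (measurable_seqComp hT k))
        fun x => h.abs_right_le k _

/-- By convexity, `exp` lies below its chord over an interval. The bound is affine in `m`, so the
linear part vanishes after integration when `m` is a martingale difference. -/
theorem exp_le {D : ℝ} (hD : 0 < D) {m : ℝ} (hm : |m| ≤ D) (l : ℝ) :
    Real.exp (l * m) ≤ Real.cosh (l * D) + m * (Real.sinh (l * D) / D) := by
  have hm' : |m / D| ≤ 1 := by rw [abs_div, abs_of_pos hD, div_le_one hD]; exact hm
  have := Real.exp_mul_le_cosh_add_mul_sinh hm' (l * D)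
  rw [show m / D * (l * D) = l * m by field_simp] at this
  exact this.trans_eq (by ring)

/-- One step of the Azuma-Hoeffding argument. -/
theorem integral_exp_diff_le (h : IsReverseMartingaleDecomp T D φ ψ) (hD : 0 < D)
    (hT : ∀ n, 1 ≤ n → Measurable (T n)) (l : ℝ) (k : ℕ) (W : I → ℝ) (hW : Measurable W)
    (hW0 : ∀ x, 0 ≤ W x) (c : ℝ) (hc : ∀ x, W x ≤ c) :
    ∫ x, Real.exp (l * (φ k (seqComp T k x) + ψ k (seqComp T k x)
        - ψ (k + 1) (seqComp T (k + 1) x))) * W (seqComp T (k + 1) x) ≤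
      Real.cosh (l * D) * ∫ x, W (seqComp T (k + 1) x) := by
  have hmk := measurable_seqComp hT k
  have hmk' := measurable_seqComp hT (k + 1)
  have hφ := (h.measurable_left k).comp hmk
  have hψ := (h.measurable_right k).comp hmk
  have hψ' := (h.measurable_right (k + 1)).comp hmk'
  have hWm := hW.comp hmk'
  have hWc : ∀ x, |W x| ≤ c := fun x => by rw [abs_of_nonneg (hW0 x)]; exact hc x
  have iW : Integrable (fun x => W (seqComp T (k + 1) x)) volume :=
    integrable_of_abs_le hWm fun x => hWc _
  have i1 : Integrable (fun x => (φ k (seqComp T k x) + ψ k (seqComp T k x)) *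
      W (seqComp T (k + 1) x)) volume :=
    iW.bdd_mul (c := 3 * D + D) (hφ.add hψ).aestronglyMeasurable
      (Filter.Eventually.of_forall fun x =>
        (abs_add_le _ _).trans (add_le_add (h.abs_left_le k _) (h.abs_right_le k _)))
  have i2 : Integrable (fun x => ψ (k + 1) (seqComp T (k + 1) x) *
      W (seqComp T (k + 1) x)) volume :=
    iW.bdd_mul (c := D) hψ'.aestronglyMeasurable
      (Filter.Eventually.of_forall fun x => h.abs_right_le _ _)
  have i3 : Integrable (fun x => (φ k (seqComp T k x) + ψ k (seqComp T k x)) *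
      W (seqComp T (k + 1) x) - ψ (k + 1) (seqComp T (k + 1) x) * W (seqComp T (k + 1) x))
      volume := i1.sub i2
  calc
    _ ≤ ∫ x, (Real.cosh (l * D) * W (seqComp T (k + 1) x) + (Real.sinh (l * D) / D) *
          ((φ k (seqComp T k x) + ψ k (seqComp T k x)) * W (seqComp T (k + 1) x)
            - ψ (k + 1) (seqComp T (k + 1) x) * W (seqComp T (k + 1) x))) := by
        refine integral_mono_of_nonneg
          (Filter.Eventually.of_forall fun x => mul_nonneg (Real.exp_pos _).le (hW0 _))
          ((iW.const_mul _).add (i3.const_mul _))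
          (Filter.Eventually.of_forall fun x => ?_)
        have := mul_le_mul_of_nonneg_right (exp_le hD
          (h.abs_diff_le k (seqComp T k x) (seqComp T (k + 1) x)) l) (hW0 (seqComp T (k + 1) x))
        refine this.trans_eq ?_
        ring
    _ = Real.cosh (l * D) * ∫ x, W (seqComp T (k + 1) x) := by
        rw [integral_add (iW.const_mul _) (i3.const_mul _), integral_const_mul,
          integral_const_mul, integral_sub i1 i2, h.integral_eq k W c hW hWc, sub_self,
          mul_zero, add_zero]

/-- The weight `W` carries the induction: the last increment depends only on `T_1^n x`, so it can be
moved into the weight of the preceding step. -/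
theorem integral_exp_sum_mul_le (h : IsReverseMartingaleDecomp T D φ ψ) (hD : 0 < D)
    (hT : ∀ n, 1 ≤ n → Measurable (T n)) (l : ℝ) (n : ℕ) (W : I → ℝ) (hW : Measurable W)
    (hW0 : ∀ x, 0 ≤ W x) (c : ℝ) (hc : ∀ x, W x ≤ c) :
    ∫ x, Real.exp (l * (∑ k ∈ Finset.range n, φ k (seqComp T k x) - ψ n (seqComp T n x))) *
        W (seqComp T n x) ≤
      Real.cosh (l * D) ^ n * ∫ x, W (seqComp T n x) := by
  induction n generalizing W c with
  | zero => simp [seqComp, h.right_zero]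
  | succ n ih =>
    have hTn := hT (n + 1) (by omega)
    let W' : I → ℝ := fun x =>
      Real.exp (l * (φ n x + ψ n x - ψ (n + 1) (T (n + 1) x))) * W (T (n + 1) x)
    have hW' : Measurable W' :=
      ((((h.measurable_left n).add (h.measurable_right n)).sub
        ((h.measurable_right (n + 1)).comp hTn)).const_mul l).exp.mul (hW.comp hTn)
    have hW'c : ∀ x, W' x ≤ Real.exp (|l| * D) * c := fun x => by
      refine mul_le_mul (Real.exp_le_exp.2 ((le_abs_self _).trans ?_)) (hc _) (hW0 _)
        (Real.exp_pos _).le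
      rw [abs_mul]
      gcongr
      exact h.abs_diff_le _ _ _
    have := ih W' hW' (fun x => mul_nonneg (Real.exp_pos _).le (hW0 _)) _ hW'c
    have e : ∀ x, Real.exp (l * (∑ k ∈ Finset.range (n + 1), φ k (seqComp T k x)
        - ψ (n + 1) (seqComp T (n + 1) x))) * W (seqComp T (n + 1) x) =
        Real.exp (l * (∑ k ∈ Finset.range n, φ k (seqComp T k x) - ψ n (seqComp T n x))) *
          W' (seqComp T n x) := fun x => by
      simp only [W', seqComp, Function.comp_apply]
      rw [← mul_assoc, ← Real.exp_add, Finset.sum_range_succ]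
      congr 2
      ring
    simp only [e]
    refine this.trans ?_
    rw [pow_succ, mul_assoc]
    gcongr
    exact h.integral_exp_diff_le hD hT l n W hW hW0 c hc

theorem measurable_sum (h : IsReverseMartingaleDecomp T D φ ψ)
    (hT : ∀ n, 1 ≤ n → Measurable (T n)) (n : ℕ) :
    Measurable fun x => ∑ k ∈ Finset.range n, φ k (seqComp T k x) :=
  Finset.measurable_fun_sum _ fun k _ => (h.measurable_left k).comp (measurable_seqComp hT k)

/-- The Azuma-Hoeffding bound for the additive functional `∑ φ k ∘ T_1^k`. -/
theorem integral_exp_sum_le (h : IsReverseMartingaleDecomp T D φ ψ) (hD : 0 < D)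
    (hT : ∀ n, 1 ≤ n → Measurable (T n)) (l : ℝ) (n : ℕ) :
    ∫ x, Real.exp (l * ∑ k ∈ Finset.range n, φ k (seqComp T k x)) ≤
      Real.exp ((n + 1) * (l * D) ^ 2 / 2) := by
  have hψ := h.measurable_right n
  have hψn := hψ.comp (measurable_seqComp hT n)
  have h1 := h.integral_exp_sum_mul_le hD hT l n (fun x => Real.exp (l * ψ n x))
    -- This weight restores the boundary term `ψ n` that the telescoping leaves behind.
    (hψ.const_mul l).exp (fun x => (Real.exp_pos _).le) (Real.exp (|l| * D)) (fun x => by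
      refine Real.exp_le_exp.2 ((le_abs_self _).trans ?_)
      rw [abs_mul]
      gcongr
      exact h.abs_right_le _ _)
  -- The boundary term is centred and bounded by `D`, so it costs one further factor `cosh`; hence
  -- `n + 1` in the exponent.
  have h2 : ∫ x, Real.exp (l * ψ n (seqComp T n x)) ≤ Real.cosh (l * D) := by
    have i : Integrable (fun x => ψ n (seqComp T n x)) volume :=
      integrable_of_abs_le hψn fun x => h.abs_right_le n _
    calc
      _ ≤ ∫ x, (Real.cosh (l * D) + ψ n (seqComp T n x) * (Real.sinh (l * D) / D)) :=
          integral_mono_of_nonneg (Filter.Eventually.of_forall fun x => (Real.exp_pos _).le)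
            ((integrable_const _).add (i.mul_const _))
            (Filter.Eventually.of_forall fun x => exp_le hD (h.abs_right_le n _) l)
      _ = _ := by
          rw [integral_add (integrable_const _) (i.mul_const _), integral_mul_const,
            h.integral_right hT n]
          simp
  calc
    _ = ∫ x, Real.exp (l * (∑ k ∈ Finset.range n, φ k (seqComp T k x) - ψ n (seqComp T n x))) *
        Real.exp (l * ψ n (seqComp T n x)) := by
        refine integral_congr_ae (Filter.Eventually.of_forall fun x => ?_)
        simp only [← Real.exp_add]
        congr 1
        ring
    _ ≤ Real.cosh (l * D) ^ n * Real.cosh (l * D) := by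
        refine h1.trans ?_
        gcongr
    _ ≤ Real.exp ((l * D) ^ 2 / 2) ^ (n + 1) := by
        rw [← pow_succ]
        gcongr
        exact Real.cosh_le_exp_half_sq _
    _ = _ := by
        rw [← Real.exp_nat_mul]
        push_cast
        congr 1
        ring

/-- `exp (l * |s|) ≤ exp (l * s) + exp (-l * s)`; this is the source of the factor 2 in the final
estimate. -/
theorem integral_exp_abs_sum_le (h : IsReverseMartingaleDecomp T D φ ψ) (hD : 0 < D)
    (hT : ∀ n, 1 ≤ n → Measurable (T n)) (l : ℝ) (n : ℕ) :
    ∫ x, Real.exp (l * |∑ k ∈ Finset.range n, φ k (seqComp T k x)|) ≤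
      2 * Real.exp ((n + 1) * (l * D) ^ 2 / 2) := by
  have hm := h.measurable_sum hT n
  have hb : ∀ x, |∑ k ∈ Finset.range n, φ k (seqComp T k x)| ≤ n * (3 * D) := fun x => by
    refine (Finset.abs_sum_le_sum_abs _ _).trans
      ((Finset.sum_le_sum fun k _ => h.abs_left_le k _).trans_eq ?_)
    simp
  have hint : ∀ l : ℝ, Integrable
      (fun x => Real.exp (l * ∑ k ∈ Finset.range n, φ k (seqComp T k x))) volume := fun l => by
    refine integrable_of_abs_le (hm.const_mul l).exp (c := Real.exp (|l| * (n * (3 * D)))) ?_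
    intro x
    rw [Real.abs_exp]
    refine Real.exp_le_exp.2 ((le_abs_self _).trans ?_)
    rw [abs_mul]
    gcongr
    exact hb x
  have h1 := h.integral_exp_sum_le hD hT l n
  have h2 := h.integral_exp_sum_le hD hT (-l) n
  rw [neg_mul, neg_sq] at h2
  calc
    _ ≤ ∫ x, (Real.exp (l * ∑ k ∈ Finset.range n, φ k (seqComp T k x)) +
          Real.exp (-l * ∑ k ∈ Finset.range n, φ k (seqComp T k x))) := by
        refine integral_mono_of_nonneg (Filter.Eventually.of_forall fun x => (Real.exp_pos _).le)
          ((hint l).add (hint (-l))) (Filter.Eventually.of_forall fun x => ?_)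
        rcases abs_choice (∑ k ∈ Finset.range n, φ k (seqComp T k x)) with hs | hs <;>
          simp only [hs, neg_mul, mul_neg] <;>
          linarith [Real.exp_pos (l * ∑ k ∈ Finset.range n, φ k (seqComp T k x)),
            Real.exp_pos (-(l * ∑ k ∈ Finset.range n, φ k (seqComp T k x)))]
    _ ≤ _ := by
        rw [integral_add (hint l) (hint (-l))]
        linarith

end IsReverseMartingaleDecomp

end ReverseMartingale

/-! ### From fixed thresholds to the Kantorovich distance. -/

section Kantorovich

variable {T : ℕ → I → I}

/-- The centred indicator function `𝟙_{[0,t]} - m (T_1^k ≤ t)`. -/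
noncomputable def centeredIndicator (T : ℕ → I → I) (t : I) (k : ℕ) (y : I) : ℝ :=
  (Set.Iic t).indicator 1 y - ((volume : Measure I).map (seqComp T k)).real (Set.Iic t)

theorem measurable_centeredIndicator (t : I) (k : ℕ) : Measurable (centeredIndicator T t k) :=
  (measurable_one.indicator measurableSet_Iic).sub measurable_const

theorem measureReal_map_seqComp (hT : ∀ n, 1 ≤ n → Measurable (T n)) (k : ℕ) (t : I) :
    ((volume : Measure I).map (seqComp T k)).real (Set.Iic t) =
      ∫ x, (Set.Iic t).indicator (1 : I → ℝ) (seqComp T k x) := by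
  have hk := measurable_seqComp hT k
  rw [← integral_map (f := (Set.Iic t).indicator (1 : I → ℝ)) hk.aemeasurable
    (measurable_one.indicator measurableSet_Iic).aestronglyMeasurable,
    integral_indicator_one measurableSet_Iic]

theorem integral_centeredIndicator (hT : ∀ n, 1 ≤ n → Measurable (T n)) (k : ℕ) (t : I) :
    ∫ x, centeredIndicator T t k (seqComp T k x) = 0 := by
  have hk := measurable_seqComp hT k
  have hi : Integrable (fun x => (Set.Iic t).indicator (1 : I → ℝ) (seqComp T k x)) volume :=
    integrable_of_abs_le ((measurable_one.indicator measurableSet_Iic).comp hk) (c := 1)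
      fun x => by by_cases h : seqComp T k x ∈ Set.Iic t <;> simp [h]
  unfold centeredIndicator
  rw [integral_sub hi (integrable_const _), ← measureReal_map_seqComp hT]
  simp

theorem abs_centeredIndicator_le (hT : ∀ n, 1 ≤ n → Measurable (T n)) (k : ℕ) (t y : I) :
    |centeredIndicator T t k y| ≤ 1 := by
  have : IsProbabilityMeasure ((volume : Measure I).map (seqComp T k)) :=
    Measure.isProbabilityMeasure_map (measurable_seqComp hT k).aemeasurable
  have h0 : 0 ≤ ((volume : Measure I).map (seqComp T k)).real (Set.Iic t) := measureReal_nonneg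
  have h1 : ((volume : Measure I).map (seqComp T k)).real (Set.Iic t) ≤ 1 := measureReal_le_one
  unfold centeredIndicator
  rw [abs_le]
  by_cases h : y ∈ Set.Iic t <;> simp only [h, Set.indicator_of_mem, Set.indicator_of_notMem,
    not_false_eq_true, Pi.one_apply] <;> constructor <;> linarith

/-- Monotonicity and boundedness alone control the variation, so no estimate below depends on `t`.
-/
theorem antitone_centeredIndicator (k : ℕ) (t : I) : Antitone (centeredIndicator T t k) := by
  intro x y hxy
  unfold centeredIndicator
  gcongr
  by_cases h : y ∈ Set.Iic t
  · have : x ∈ Set.Iic t := hxy.trans h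
    simp [h, this]
  · rw [Set.indicator_of_notMem h]
    exact Set.indicator_nonneg (fun _ _ => zero_le_one) _

theorem measurable_sum_centeredIndicator_uncurry (hT : ∀ n, 1 ≤ n → Measurable (T n)) (n : ℕ) :
    Measurable fun p : I × I =>
      ∑ k ∈ Finset.range n, centeredIndicator T p.2 k (seqComp T k p.1) := by
  refine Finset.measurable_fun_sum _ fun k _ => ?_
  have hk := measurable_seqComp hT k
  have hset : MeasurableSet {p : I × I | p.1 ≤ p.2} := measurableSet_le measurable_fst measurable_snd
  have h1 : Measurable fun p : I × I => (Set.Iic p.2).indicator (1 : I → ℝ) p.1 := by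
    have : (fun p : I × I => (Set.Iic p.2).indicator (1 : I → ℝ) p.1) =
        {p : I × I | p.1 ≤ p.2}.indicator 1 := by
      ext p
      simp [Set.indicator_apply]
    rw [this]
    exact measurable_one.indicator hset
  have h2 : Measurable fun p : I × I => (Set.Iic p.2).indicator (1 : I → ℝ) (seqComp T k p.1) :=
    h1.comp ((hk.comp measurable_fst).prodMk measurable_snd)
  unfold centeredIndicator
  refine h2.sub ?_
  -- Written as an integral, the centring constant is measurable in the threshold by Fubini.
  simp only [measureReal_map_seqComp hT]
  have h3 : Measurable fun q : I × I => (Set.Iic q.1).indicator (1 : I → ℝ) (seqComp T k q.2) :=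
    h2.comp measurable_swap
  exact (h3.stronglyMeasurable.integral_prod_right'
    (f := fun q : I × I => (Set.Iic q.1).indicator (1 : I → ℝ) (seqComp T k q.2))).measurable.comp measurable_snd

theorem abs_sum_centeredIndicator_le (hT : ∀ n, 1 ≤ n → Measurable (T n)) (n : ℕ) (t x : I) :
    |∑ k ∈ Finset.range n, centeredIndicator T t k (seqComp T k x)| ≤ n := by
  refine (Finset.abs_sum_le_sum_abs _ _).trans
    ((Finset.sum_le_sum fun k _ => abs_centeredIndicator_le hT k t _).trans_eq ?_)
  simp

theorem mul_kantorovich_eq {n : ℕ} (hn : 1 ≤ n) (x : I) :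
    n * kantorovich (empiricalMeasure T n x) (meanMeasure T n) =
      ∫ t : I, |∑ k ∈ Finset.range n, centeredIndicator T t k (seqComp T k x)| := by
  have hn' : (0 : ℝ) < n := by exact_mod_cast hn
  unfold kantorovich
  rw [← integral_const_mul]
  refine integral_congr_ae (Filter.Eventually.of_forall fun t => ?_)
  simp only [empiricalMeasure, meanMeasure, measureReal_ennreal_smul_apply, centeredIndicator]
  rw [measureReal_def, measureReal_def, Measure.finsetSum_apply, Measure.finsetSum_apply,
    ENNReal.toReal_sum (fun _ _ => measure_ne_top _ _),
    ENNReal.toReal_sum (fun _ _ => measure_ne_top _ _), ← mul_sub, abs_mul,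
    Finset.sum_sub_distrib]
  have h1 : ∀ k, ((Measure.dirac (seqComp T k x)) (Set.Iic t)).toReal =
      (Set.Iic t).indicator (1 : I → ℝ) (seqComp T k x) := fun k => by
    rw [Measure.dirac_apply' _ measurableSet_Iic]
    by_cases h : seqComp T k x ∈ Set.Iic t <;> simp [h]
  simp only [h1, measureReal_def, ENNReal.toReal_inv, ENNReal.toReal_natCast, abs_inv, Nat.abs_cast]
  field_simp

/-- The parameter is `l = t / (2 √n D²)`. With `q = t² / (4D²)` the linear term is `-2q`, and the
quadratic one is at most `n (lD)² = q` because `n + 1 ≤ 2n`. -/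
theorem chernoff_exponent_le {D : ℝ} (hD : 0 < D) (t : ℝ) {n : ℕ} (hn : 1 ≤ n) :
    -(t / (2 * Real.sqrt n * D ^ 2)) * (t * Real.sqrt n) +
        (n + 1) * (t / (2 * Real.sqrt n * D ^ 2) * D) ^ 2 / 2 ≤
      -(1 / (4 * D ^ 2) * t ^ 2) := by
  have hn' : (1 : ℝ) ≤ n := by exact_mod_cast hn
  have hs : 0 < Real.sqrt n := Real.sqrt_pos.2 (by linarith)
  have hss : Real.sqrt n ^ 2 = n := Real.sq_sqrt (by linarith)
  set l : ℝ := t / (2 * Real.sqrt n * D ^ 2) with hl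
  have e1 : -l * (t * Real.sqrt n) = -(t ^ 2 / (2 * D ^ 2)) := by
    rw [hl]
    field_simp
  have e2 : n * (l * D) ^ 2 = t ^ 2 / (4 * D ^ 2) := by
    have e : l * D = t / (2 * Real.sqrt n * D) := by
      rw [hl]
      field_simp
    rw [e, div_pow, mul_pow, mul_pow, hss]
    field_simp
    norm_num
  have e3 : (l * D) ^ 2 ≤ n * (l * D) ^ 2 := le_mul_of_one_le_left (sq_nonneg _) hn'
  have e4 : t ^ 2 / (2 * D ^ 2) = 2 * (t ^ 2 / (4 * D ^ 2)) := by
    field_simp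
    norm_num
  have e5 : 1 / (4 * D ^ 2) * t ^ 2 = t ^ 2 / (4 * D ^ 2) := by ring
  rw [e1, e5]
  linarith

/-- Chernoff's bound for the average of a bounded random process whose exponential moments are
uniformly controlled. -/
theorem measureReal_integral_ge_le {Z : I → I → ℝ} (hZm : Measurable (Function.uncurry Z))
    {c : ℝ} (hZ0 : ∀ x t, 0 ≤ Z x t) (hZb : ∀ x t, Z x t ≤ c) {l : ℝ} (hl : 0 ≤ l) {A : ℝ}
    (hA : ∀ t, ∫ x, Real.exp (l * Z x t) ≤ A) (ε : ℝ) :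
    (volume : Measure I).real {x | ε ≤ ∫ t, Z x t} ≤ Real.exp (-l * ε) * A := by
  have hXm : Measurable fun x => ∫ t, Z x t := hZm.stronglyMeasurable.integral_prod_right.measurable
  have hXb : ∀ x, ∫ t, Z x t ≤ c := fun x => by
    have : ∫ t, Z x t ≤ ∫ t : I, c :=
      integral_mono_of_nonneg (Filter.Eventually.of_forall (hZ0 x)) (integrable_const _)
        (Filter.Eventually.of_forall (hZb x))
    simpa using this
  have hexpm : Measurable fun p : I × I => Real.exp (l * Z p.1 p.2) := (hZm.const_mul l).exp
  have hexpb : ∀ x t, |Real.exp (l * Z x t)| ≤ Real.exp (l * c) := fun x t => by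
    rw [Real.abs_exp]
    exact Real.exp_le_exp.2 (mul_le_mul_of_nonneg_left (hZb x t) hl)
  have hZi : ∀ x, Integrable (Z x) volume := fun x =>
    integrable_of_abs_le (hZm.comp measurable_prodMk_left) (c := c) fun t => by
      rw [abs_of_nonneg (hZ0 x t)]
      exact hZb x t
  have hZei : ∀ x, Integrable (fun t => Real.exp (l * Z x t)) volume := fun x =>
    integrable_of_abs_le (hexpm.comp measurable_prodMk_left) (hexpb x)
  have hprod : Integrable (fun p : I × I => Real.exp (l * Z p.1 p.2)) (volume.prod volume) :=
    Integrable.of_bound hexpm.aestronglyMeasurable (Real.exp (l * c))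
      (Filter.Eventually.of_forall fun p => hexpb _ _)
  -- The average over `t` is taken with respect to a probability measure, so convexity of `exp`
  -- pulls it outside.
  have hjensen : ∀ x, Real.exp (l * ∫ t, Z x t) ≤ ∫ t, Real.exp (l * Z x t) := fun x => by
    have := convexOn_exp.map_integral_le (μ := (volume : Measure I)) (f := fun t => l * Z x t)
      Real.continuous_exp.continuousOn isClosed_univ (Filter.Eventually.of_forall fun _ => trivial)
      ((hZi x).const_mul l) (hZei x)
    rwa [integral_const_mul] at this
  have hmgf : ∫ x, Real.exp (l * ∫ t, Z x t) ≤ A := by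
    calc
      _ ≤ ∫ x, ∫ t, Real.exp (l * Z x t) :=
        integral_mono_of_nonneg (Filter.Eventually.of_forall fun x => (Real.exp_pos _).le)
          hprod.integral_prod_left (Filter.Eventually.of_forall hjensen)
      _ = ∫ t, ∫ x, Real.exp (l * Z x t) := integral_integral_swap hprod
      _ ≤ ∫ t : I, A :=
        integral_mono_of_nonneg
          (Filter.Eventually.of_forall fun t => integral_nonneg fun x => (Real.exp_pos _).le)
          (integrable_const _) (Filter.Eventually.of_forall hA)
      _ = _ := by simp
  have hXe : Integrable (fun x => Real.exp (l * ∫ t, Z x t)) volume :=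
    integrable_of_abs_le (hXm.const_mul l).exp (c := Real.exp (l * c)) fun x => by
      rw [Real.abs_exp]
      exact Real.exp_le_exp.2 (mul_le_mul_of_nonneg_left (hXb x) hl)
  exact (ProbabilityTheory.measure_ge_le_exp_mul_mgf ε hl hXe).trans
    (mul_le_mul_of_nonneg_left hmgf (Real.exp_pos _).le)

/-- Concentration of the Kantorovich distance, from martingale decompositions of the centred
indicator functions that are bounded uniformly in the threshold. -/
theorem kantorovich_tail_le (hT : ∀ n, 1 ≤ n → Measurable (T n)) {D : ℝ} (hD : 0 < D)
    (h : ∀ t : I, ∃ ψ, IsReverseMartingaleDecomp T D (centeredIndicator T t) ψ) {t : ℝ}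
    (ht : 0 < t) {n : ℕ} (hn : 1 ≤ n) :
    (volume : Measure I).real
        {x | kantorovich (empiricalMeasure T n x) (meanMeasure T n) > t / Real.sqrt n} ≤
      2 * Real.exp (-(1 / (4 * D ^ 2) * t ^ 2)) := by
  have hn' : (0 : ℝ) < n := by exact_mod_cast hn
  have hs : 0 < Real.sqrt n := Real.sqrt_pos.2 hn'
  have hss : Real.sqrt n ^ 2 = n := Real.sq_sqrt hn'.le
  have hl : 0 ≤ t / (2 * Real.sqrt n * D ^ 2) := by positivity
  have hcher := measureReal_integral_ge_le
    (Z := fun x t => |∑ k ∈ Finset.range n, centeredIndicator T t k (seqComp T k x)|)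
    (continuous_abs.measurable.comp (measurable_sum_centeredIndicator_uncurry hT n))
    (fun x t => abs_nonneg _) (fun x t => abs_sum_centeredIndicator_le hT n t x) hl
    (A := 2 * Real.exp ((n + 1) * (t / (2 * Real.sqrt n * D ^ 2) * D) ^ 2 / 2))
    (fun s => by
      obtain ⟨ψ, hψ⟩ := h s
      exact hψ.integral_exp_abs_sum_le hD hT _ n) (t * Real.sqrt n)
  calc
    _ ≤ (volume : Measure I).real {x | t * Real.sqrt n ≤
          ∫ s : I, |∑ k ∈ Finset.range n, centeredIndicator T s k (seqComp T k x)|} := by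
      refine measureReal_mono (fun x hx => ?_)
      have hx' : t / Real.sqrt n < kantorovich (empiricalMeasure T n x) (meanMeasure T n) := hx
      rw [Set.mem_ofPred_eq, ← mul_kantorovich_eq hn x]
      calc
        t * Real.sqrt n = Real.sqrt n ^ 2 * (t / Real.sqrt n) := by field_simp
        _ = n * (t / Real.sqrt n) := by rw [hss]
        _ ≤ _ := mul_le_mul_of_nonneg_left hx'.le hn'.le
    _ ≤ _ := hcher
    _ = 2 * Real.exp (-(t / (2 * Real.sqrt n * D ^ 2)) * (t * Real.sqrt n) +
          (n + 1) * (t / (2 * Real.sqrt n * D ^ 2) * D) ^ 2 / 2) := by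
      rw [Real.exp_add]
      ring
    _ ≤ _ := mul_le_mul_of_nonneg_left (Real.exp_le_exp.2 (chernoff_exponent_le hD t hn))
      zero_le_two

end Kantorovich

/-! ### Sup bounds and products in `BV`. -/

section BoundedVariation

theorem eVariationOn_mul_le {α : Type*} [LinearOrder α] {u g : α → ℝ} {s : Set α} {A B : ℝ}
    (hu : ∀ x, |u x| ≤ A) (hg : ∀ x, |g x| ≤ B) :
    eVariationOn (fun x => u x * g x) s ≤
      ENNReal.ofReal A * eVariationOn g s + ENNReal.ofReal B * eVariationOn u s := by
  refine iSup_le fun p => ?_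
  have key : ∀ x y, edist (u x * g x) (u y * g y) ≤
      ENNReal.ofReal A * edist (g x) (g y) + ENNReal.ofReal B * edist (u x) (u y) := fun x y => by
    have hA := (abs_nonneg _).trans (hu x)
    have hB := (abs_nonneg _).trans (hg x)
    rw [edist_dist, edist_dist, edist_dist, ← ENNReal.ofReal_mul hA, ← ENNReal.ofReal_mul hB,
      ← ENNReal.ofReal_add (by positivity) (by positivity)]
    refine ENNReal.ofReal_le_ofReal ?_
    simp only [Real.dist_eq]
    calc
      |u x * g x - u y * g y| = |u x * (g x - g y) + g y * (u x - u y)| := by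
        congr 1
        ring
      _ ≤ |u x| * |g x - g y| + |g y| * |u x - u y| := by
        rw [← abs_mul, ← abs_mul]
        exact abs_add_le _ _
      _ ≤ _ := by
        gcongr
        · exact hu x
        · exact hg y
  calc
    _ ≤ ∑ i ∈ Finset.range p.1,
        (ENNReal.ofReal A * edist (g ((p.2 : ℕ → α) (i + 1))) (g ((p.2 : ℕ → α) i)) +
          ENNReal.ofReal B * edist (u ((p.2 : ℕ → α) (i + 1))) (u ((p.2 : ℕ → α) i))) :=
      Finset.sum_le_sum fun i _ => key _ _
    _ ≤ _ := by
      rw [Finset.sum_add_distrib, ← Finset.mul_sum, ← Finset.mul_sum]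
      gcongr
      · exact eVariationOn.sum_le p.2.2.1 p.2.2.2
      · exact eVariationOn.sum_le p.2.2.1 p.2.2.2

theorem eVariationOn_univ_le_of_antitone {u : I → ℝ} (hu : Antitone u) {A : ℝ}
    (hA : ∀ x, |u x| ≤ A) : eVariationOn u Set.univ ≤ ENNReal.ofReal (2 * A) := by
  have hneg : eVariationOn u Set.univ = eVariationOn (fun x => -u x) Set.univ := by
    simp only [eVariationOn, edist_neg_neg]
  have h := ((hu.neg.monotoneOn Set.univ).eVariationOn_eq (Set.mem_univ (0 : I))
    (Set.mem_univ (1 : I))).le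
  have hI : Set.univ ∩ Set.Icc (0 : I) 1 = Set.univ := by
    ext x
    simp [unitInterval.le_one']
  rw [hI] at h
  rw [hneg]
  refine h.trans (ENNReal.ofReal_le_ofReal ?_)
  have h0 := abs_le.1 (hA 0)
  have h1 := abs_le.1 (hA 1)
  linarith

theorem bvNorm_nonneg (f : L1) : 0 ≤ bvNorm f := add_nonneg ENNReal.toReal_nonneg (norm_nonneg _)

/-- A function in `BV` has a representative whose variation is almost minimal. -/
theorem IsBV.exists_representative {f : L1} (hf : IsBV f) {ε : ℝ} (hε : 0 < ε) :
    ∃ g : I → ℝ, g =ᵐ[volume] f ∧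
      eVariationOn g Set.univ ≤ ENNReal.ofReal ((essVar f).toReal + ε) ∧
      ∀ x, |g x| ≤ bvNorm f + ε := by
  have hlt : essVar f < ENNReal.ofReal ((essVar f).toReal + ε) := by
    rw [ENNReal.lt_ofReal_iff_toReal_lt hf]
    linarith
  obtain ⟨g, hg⟩ := iInf_lt_iff.1 hlt
  obtain ⟨hgf, hgv⟩ := iInf_lt_iff.1 hg
  refine ⟨g, hgf, hgv.le, fun x => ?_⟩
  have hgi : Integrable g volume := (L1.integrable_coeFn f).congr hgf.symm
  have hgn : ∫ y, |g y| = ‖f‖ := by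
    rw [L1.norm_eq_integral_norm]
    exact integral_congr_ae (hgf.mono fun y hy => by simp only [hy, Real.norm_eq_abs])
  -- The oscillation is at most the variation; averaging over `y` turns this into a pointwise bound
  -- by the variation plus the `L¹` norm.
  have hxy : ∀ y, |g x| ≤ (essVar f).toReal + ε + |g y| := fun y => by
    have h1 := (eVariationOn.edist_le g (Set.mem_univ x) (Set.mem_univ y)).trans hgv.le
    rw [edist_dist, ENNReal.ofReal_le_ofReal_iff (by positivity), Real.dist_eq] at h1
    have := abs_sub_abs_le_abs_sub (g x) (g y)
    linarith
  have h2 : ∫ y : I, |g x| ≤ ∫ y, ((essVar f).toReal + ε + |g y|) :=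
    integral_mono (integrable_const _) ((integrable_const _).add hgi.abs) hxy
  rw [integral_add (integrable_const _) hgi.abs, hgn] at h2
  simp only [integral_const, probReal_univ, one_smul] at h2
  unfold bvNorm
  linarith

theorem IsBV.abs_le_bvNorm {f : L1} (hf : IsBV f) : ∀ᵐ x, |f x| ≤ bvNorm f := by
  have h : ∀ n : ℕ, ∀ᵐ x, |f x| ≤ bvNorm f + 1 / ((n : ℝ) + 1) := fun n => by
    obtain ⟨g, hg, -, hb⟩ := hf.exists_representative (ε := 1 / ((n : ℝ) + 1)) (by positivity)
    filter_upwards [hg] with x hx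
    rw [← hx]
    exact hb x
  filter_upwards [ae_all_iff.2 h] with x hx
  have hlim : Filter.Tendsto (fun n : ℕ => bvNorm f + 1 / ((n : ℝ) + 1)) Filter.atTop
      (nhds (bvNorm f + 0)) := tendsto_one_div_add_atTop_nhds_zero_nat.const_add _
  rw [add_zero] at hlim
  exact ge_of_tendsto' hlim hx

/-- Multiplication by an antitone function with values in `[-1,1]` is bounded on `BV`. -/
theorem IsBV.antitone_mul {f v : L1} (hf : IsBV f) {u : I → ℝ} (hu : Antitone u)
    (hu1 : ∀ x, |u x| ≤ 1) (hv : v =ᵐ[volume] fun x => u x * f x) :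
    IsBV v ∧ bvNorm v ≤ 3 * bvNorm f := by
  have hnorm : ‖v‖ ≤ ‖f‖ := by
    rw [L1.norm_eq_integral_norm, L1.norm_eq_integral_norm]
    refine integral_mono_ae (L1.integrable_coeFn v).norm (L1.integrable_coeFn f).norm ?_
    filter_upwards [hv] with x hx
    rw [hx, norm_mul]
    exact mul_le_of_le_one_left (norm_nonneg _) (hu1 x)
  -- Leibniz rule: `sup |u| ≤ 1` multiplies the variation of `f`, and the variation of `u`, at most
  -- 2, multiplies the sup of `f`. Adding `‖v‖ ≤ ‖f‖` gives the constant 3.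
  have hvar : ∀ ε : ℝ, 0 < ε → essVar v ≤
      ENNReal.ofReal ((essVar f).toReal + 2 * bvNorm f + 3 * ε) := fun ε hε => by
    obtain ⟨g, hg, hgv, hgb⟩ := hf.exists_representative hε
    have hb : 0 ≤ bvNorm f := bvNorm_nonneg f
    have he : 0 ≤ (essVar f).toReal := ENNReal.toReal_nonneg
    have hug : (fun x => u x * g x) =ᵐ[volume] v := by
      filter_upwards [hv, hg] with x hx hx'
      rw [hx, hx']
    calc
      essVar v ≤ eVariationOn (fun x => u x * g x) Set.univ := iInf₂_le
        (f := fun (g : I → ℝ) (_ : g =ᵐ[volume] v) => eVariationOn g Set.univ) _ hug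
      _ ≤ _ := eVariationOn_mul_le hu1 hgb
      _ ≤ ENNReal.ofReal 1 * ENNReal.ofReal ((essVar f).toReal + ε) +
          ENNReal.ofReal (bvNorm f + ε) * ENNReal.ofReal (2 * 1) := by
        gcongr
        exact eVariationOn_univ_le_of_antitone hu hu1
      _ = _ := by
        rw [← ENNReal.ofReal_mul (by positivity), ← ENNReal.ofReal_mul (by positivity),
          ← ENNReal.ofReal_add (by positivity) (by positivity)]
        congr 1
        ring
  have hbv : IsBV v := ne_top_of_le_ne_top ENNReal.ofReal_ne_top (hvar 1 one_pos)
  refine ⟨hbv, ?_⟩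
  have hvr : (essVar v).toReal ≤ (essVar f).toReal + 2 * bvNorm f := by
    refine le_of_forall_pos_le_add fun ε hε => ?_
    have := hvar (ε / 3) (by positivity)
    have hb : 0 ≤ bvNorm f := bvNorm_nonneg f
    have he : 0 ≤ (essVar f).toReal := ENNReal.toReal_nonneg
    have h2 := ENNReal.toReal_le_of_le_ofReal (by positivity) this
    linarith
  have e : bvNorm f = (essVar f).toReal + ‖f‖ := rfl
  have e' : bvNorm v = (essVar v).toReal + ‖v‖ := rfl
  linarith

end BoundedVariation

/-! ### The densities `P_1^k 𝟙` and the iterated operators. -/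

section Densities

variable {𝒞 : Set (I → I)} {T : ℕ → I → I}

/-- The composition `P_{a+l} ⋯ P_{a+1}` of the transfer operators of a sequence of maps. -/
noncomputable def iterOp (T : ℕ → I → I) (a : ℕ) : ℕ → L1 → L1
  | 0 => id
  | l + 1 => transferOp (T (a + l + 1)) ∘ iterOp T a l

/-- The density `P_1^k 𝟙` of the image of Lebesgue measure under `T_1^k`. -/
noncomputable def density (T : ℕ → I → I) (k : ℕ) : L1 :=
  iterOp T 0 k (Lp.const 1 (volume : Measure I) (1 : ℝ))

theorem iterOp_add (T : ℕ → I → I) (a k r : ℕ) (f : L1) :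
    iterOp T a (k + r) f = iterOp T (a + k) r (iterOp T a k f) := by
  induction r with
  | zero => rfl
  | succ r ih =>
    change transferOp (T (a + (k + r) + 1)) (iterOp T a (k + r) f) = _
    rw [ih, ← add_assoc]
    rfl

theorem density_add (T : ℕ → I → I) (k r : ℕ) :
    density T (k + r) = iterOp T k r (density T k) := by
  unfold density
  rw [iterOp_add, zero_add]

theorem density_succ (T : ℕ → I → I) (k : ℕ) :
    density T (k + 1) = transferOp (T (k + 1)) (density T k) :=
  density_add T k 1

theorem exists_list_applyOps_eq (hT : ∀ n, 1 ≤ n → T n ∈ 𝒞) (a l : ℕ) :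
    ∃ Ps : List (L1 → L1), Ps.length = l ∧ (∀ P ∈ Ps, P ∈ transferOp '' 𝒞) ∧
      ∀ f, applyOps Ps f = iterOp T a l f := by
  induction l with
  | zero => exact ⟨[], rfl, by simp, fun f => rfl⟩
  | succ l ih =>
    obtain ⟨Ps, h1, h2, h3⟩ := ih
    refine ⟨Ps ++ [transferOp (T (a + l + 1))], by simp [h1], fun P hP => ?_, fun f => ?_⟩
    · rcases List.mem_append.1 hP with hP | hP
      · exact h2 P hP
      · rw [List.mem_singleton.1 hP]
        exact ⟨_, hT _ (by omega), rfl⟩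
    · have : applyOps (Ps ++ [transferOp (T (a + l + 1))]) f =
          transferOp (T (a + l + 1)) (applyOps Ps f) := by
        simp [applyOps]
      rw [this, h3]
      rfl

theorem integral_iterOp
    (hT : ∀ n, 1 ≤ n → Measure.QuasiMeasurePreserving (T n) (volume : Measure I) volume)
    (a l : ℕ) (f : L1) : ∫ x, iterOp T a l f x = ∫ x, f x := by
  induction l with
  | zero => rfl
  | succ l ih => exact (integral_transferOp (hT _ (by omega)) _).trans ih

theorem quasiMeasurePreserving_seqComp
    (hT : ∀ n, 1 ≤ n → Measure.QuasiMeasurePreserving (T n) (volume : Measure I) volume) (k : ℕ) :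
    Measure.QuasiMeasurePreserving (seqComp T k) (volume : Measure I) volume := by
  induction k with
  | zero => exact Measure.QuasiMeasurePreserving.id _
  | succ k ih => exact (hT (k + 1) (by omega)).comp ih

theorem coeFn_one : (Lp.const 1 (volume : Measure I) (1 : ℝ) : I → ℝ) =ᵐ[volume] fun _ => 1 :=
  Lp.coeFn_const ..

theorem integral_density_mul
    (hT : ∀ n, 1 ≤ n → Measure.QuasiMeasurePreserving (T n) (volume : Measure I) volume) (k : ℕ)
    {W : I → ℝ} (hW : Measurable W) {c : ℝ} (hc : ∀ x, |W x| ≤ c) :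
    ∫ x, density T k x * W x = ∫ x, W (seqComp T k x) := by
  induction k generalizing W with
  | zero =>
    refine integral_congr_ae ?_
    filter_upwards [coeFn_one] with x hx
    change (Lp.const 1 (volume : Measure I) (1 : ℝ) : L1) x * W x = W x
    rw [hx, one_mul]
  | succ k ih =>
    have hTk := hT (k + 1) (by omega)
    rw [density_succ, integral_transferOp_mul hTk _ hW hc]
    exact ih (hW.comp hTk.measurable) fun x => hc _

/-- (Min) concerns the operator of a composition, whereas `(D_r)` and (Dec) concern compositions of
operators. Both sides have the same integral over every Borel set. -/
theorem transferOp_seqComp_one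
    (hT : ∀ n, 1 ≤ n → Measure.QuasiMeasurePreserving (T n) (volume : Measure I) volume) (k : ℕ) :
    transferOp (seqComp T k) (Lp.const 1 (volume : Measure I) (1 : ℝ)) = density T k := by
  have hk := quasiMeasurePreserving_seqComp hT k
  refine Lp.ext ((L1.integrable_coeFn _).ae_eq_of_forall_setIntegral_eq _ _
    (L1.integrable_coeFn _) fun s hs _ => ?_)
  have hm : Measurable (s.indicator (1 : I → ℝ)) := measurable_one.indicator hs
  have hb : ∀ x, |s.indicator (1 : I → ℝ) x| ≤ 1 := fun x => by
    by_cases h : x ∈ s <;> simp [h]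
  have key : ∀ f : L1, ∫ x in s, f x = ∫ x, f x * s.indicator (1 : I → ℝ) x := fun f => by
    rw [← integral_indicator hs]
    congr 1 with x
    by_cases h : x ∈ s <;> simp [h]
  rw [key, key, integral_transferOp_mul hk _ hm hb, integral_density_mul hT k hm hb]
  refine integral_congr_ae ?_
  filter_upwards [coeFn_one] with x hx
  rw [hx, one_mul]

theorem CondMin.exists_le_density (hMin : CondMin T)
    (hT : ∀ n, 1 ≤ n → Measure.QuasiMeasurePreserving (T n) (volume : Measure I) volume) :
    ∃ δ : ℝ, 0 < δ ∧ ∀ k, ∀ᵐ x, δ ≤ density T k x := by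
  obtain ⟨δ, hδ, h⟩ := hMin
  -- (Min) starts at `n = 1`; the minimum with 1 covers the initial density `𝟙`.
  refine ⟨min δ 1, lt_min hδ one_pos, fun k => ?_⟩
  rcases Nat.eq_zero_or_pos k with rfl | hk
  · filter_upwards [coeFn_one] with x hx
    exact (min_le_right _ _).trans_eq hx.symm
  · filter_upwards [h k hk] with x hx
    rw [← transferOp_seqComp_one hT]
    exact (min_le_left _ _).trans hx

theorem norm_density
    (hT : ∀ n, 1 ≤ n → Measure.QuasiMeasurePreserving (T n) (volume : Measure I) volume) {k : ℕ}
    (h : ∀ᵐ x, 0 ≤ density T k x) : ‖density T k‖ = 1 := by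
  rw [L1.norm_eq_integral_norm]
  have := integral_density_mul hT k (W := fun _ => 1) measurable_const (c := 1) (by simp)
  simp only [mul_one, integral_const, probReal_univ, smul_eq_mul] at this
  rw [← this]
  refine integral_congr_ae ?_
  filter_upwards [h] with x hx
  exact Real.norm_of_nonneg hx

theorem essVar_one : essVar (Lp.const 1 (volume : Measure I) (1 : ℝ)) = 0 := by
  refine le_antisymm ?_ bot_le
  refine (iInf₂_le (f := fun (g : I → ℝ)
    (_ : g =ᵐ[volume] (Lp.const 1 (volume : Measure I) (1 : ℝ) : I → ℝ)) =>
      eVariationOn g Set.univ) (fun _ => 1) coeFn_one.symm).trans_eq ?_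
  exact eVariationOn.constant_on (Set.subsingleton_singleton.anti (by
    rintro _ ⟨x, -, rfl⟩
    rfl : (fun _ : I => (1 : ℝ)) '' Set.univ ⊆ {1}))

/-- Under the Lasota-Yorke inequalities, the densities `P_1^k 𝟙` are bounded in `BV`. -/
theorem CondD.exists_bvNorm_density_le {r : ℕ} (hD : CondD r 𝒞) (hT𝒞 : ∀ n, 1 ≤ n → T n ∈ 𝒞)
    (hnorm : ∀ k, ‖density T k‖ = 1) :
    ∃ B : ℝ, 0 < B ∧ ∀ k, IsBV (density T k) ∧ bvNorm (density T k) ≤ B := by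
  obtain ⟨hr, hinv, ρ, M₀, C, hρ, hρ1, hM, hC, h1, h2⟩ := hD
  have hbv : ∀ k, IsBV (density T k) := fun k => by
    induction k with
    | zero =>
      change essVar (Lp.const 1 (volume : Measure I) (1 : ℝ)) ≠ ∞
      simp [essVar_one]
    | succ k ih =>
      rw [density_succ]
      exact hinv _ ⟨_, hT𝒞 _ (by omega), rfl⟩ _ ih
  have hsmall : ∀ k, bvNorm (density T k) ≤ max M₀ 1 ^ k := fun k => by
    induction k with
    | zero =>
      have e : (essVar (density T 0)).toReal = 0 := by
        change (essVar (Lp.const 1 (volume : Measure I) (1 : ℝ))).toReal = 0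
        simp [essVar_one]
      simp [bvNorm, e, hnorm 0]
    | succ k ih =>
      rw [density_succ, pow_succ']
      exact (h1 _ ⟨_, hT𝒞 _ (by omega), rfl⟩ _ (hbv k)).trans
        (mul_le_mul (le_max_left _ _) ih (bvNorm_nonneg _) (by positivity))
  have hM1 : (1 : ℝ) ≤ max M₀ 1 := le_max_right _ _
  have hρ' : 0 < 1 - ρ := by linarith
  -- The bound `B` satisfies `ρ * B + C ≤ B`, so it propagates over blocks of length `r`; the first
  -- summand takes care of `k < r`.
  refine ⟨max M₀ 1 ^ r + C / (1 - ρ), by positivity, fun k => ⟨hbv k, ?_⟩⟩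
  induction k using Nat.strong_induction_on with
  | _ k ih =>
    rcases lt_or_ge k r with hk | hk
    · exact (hsmall k).trans ((pow_le_pow_right₀ hM1 hk.le).trans
        (le_add_of_nonneg_right (by positivity)))
    · obtain ⟨j, rfl⟩ := Nat.exists_eq_add_of_le' hk
      obtain ⟨Ps, hl, hP, hPs⟩ := exists_list_applyOps_eq hT𝒞 j r
      have := h2 Ps hl hP (density T j) (hbv j)
      rw [hPs, ← density_add, hnorm, mul_one] at this
      have hj := mul_le_mul_of_nonneg_left (ih j (by omega)) hρ.le
      have hC' : C / (1 - ρ) * (1 - ρ) = C := by field_simp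
      have hp : 0 ≤ (1 - ρ) * max M₀ 1 ^ r := by positivity
      nlinarith

/-- The decorrelation property for the operators `P_{a+l} ⋯ P_{a+1}`, with a rate in `[0,1)`. -/
theorem CondDec.exists_iterOp_bound (hDec : CondDec 𝒞) (hT𝒞 : ∀ n, 1 ≤ n → T n ∈ 𝒞)
    (hT : ∀ n, 1 ≤ n → Measure.QuasiMeasurePreserving (T n) (volume : Measure I) volume) :
    ∃ θ K : ℝ, 0 ≤ θ ∧ θ < 1 ∧ 0 < K ∧ ∀ (a l : ℕ), 1 ≤ l → ∀ f : L1, IsBV f →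
      ∫ x, f x = 0 → IsBV (iterOp T a l f) ∧ bvNorm (iterOp T a l f) ≤ K * θ ^ l * bvNorm f := by
  obtain ⟨θ, K, hθ, hK, h⟩ := hDec
  have hiter : ∀ (a l : ℕ), 1 ≤ l → ∀ f : L1, IsBV f → ∫ x, f x = 0 →
      IsBV (iterOp T a l f) ∧ bvNorm (iterOp T a l f) ≤ K * θ ^ l * bvNorm f := by
    intro a l hl f hf h0
    obtain ⟨Ps, h1, h2, h3⟩ := exists_list_applyOps_eq hT𝒞 a l
    have := h l hl Ps h1 h2 f hf h0
    rwa [h3] at this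
  rcases le_or_gt 0 θ with h0 | h0
  · exact ⟨θ, K, h0, hθ, hK, hiter⟩
  -- (Dec) allows `θ < 0`. A single step then has nonpositive norm, so applying the case `l = 1` to
  -- the last operator gives rate 0.
  · refine ⟨0, K, le_rfl, one_pos, hK, fun a l hl f hf hf0 => ⟨(hiter a l hl f hf hf0).1, ?_⟩⟩
    obtain ⟨l, rfl⟩ := Nat.exists_eq_add_of_le' hl
    have hu : IsBV (iterOp T a l f) := by
      rcases Nat.eq_zero_or_pos l with rfl | hl'
      · exact hf
      · exact (hiter a l hl' f hf hf0).1
    have hu0 : ∫ x, iterOp T a l f x = 0 := by rw [integral_iterOp hT, hf0]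
    have := (hiter (a + l) 1 le_rfl _ hu hu0).2
    rw [← iterOp_add] at this
    refine this.trans ?_
    rw [zero_pow (by omega), mul_zero, zero_mul, pow_one]
    exact mul_nonpos_of_nonpos_of_nonneg (mul_nonpos_of_nonneg_of_nonpos hK.le h0.le)
      (bvNorm_nonneg _)

end Densities

/-! ### Construction of the martingale decomposition. -/

section Decomposition

variable {𝒞 : Set (I → I)} {T : ℕ → I → I}

theorem sum_pow_sub_le {θ : ℝ} (h0 : 0 ≤ θ) (h1 : θ < 1) (p : ℕ) :
    ∑ j ∈ Finset.range p, θ ^ (p - j) ≤ 1 / (1 - θ) := by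
  have h : 0 < 1 - θ := by linarith
  induction p with
  | zero =>
    simp only [Finset.range_zero, Finset.sum_empty]
    positivity
  | succ p ih =>
    have e : ∑ j ∈ Finset.range (p + 1), θ ^ (p + 1 - j) =
        θ * ∑ j ∈ Finset.range p, θ ^ (p - j) + θ := by
      rw [Finset.sum_range_succ, Finset.mul_sum, Nat.add_sub_cancel_left, pow_one]
      congr 1
      refine Finset.sum_congr rfl fun j hj => ?_
      have := Finset.mem_range.1 hj
      rw [← pow_succ', Nat.sub_add_comm this.le]
    have h2 : 1 / (1 - θ) = θ * (1 / (1 - θ)) + 1 := by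
      field_simp
      ring
    rw [e, h2]
    gcongr

/-- The functions `∑_{j<p} P_{j+1}^p f_j`. -/
noncomputable def pushSum (T : ℕ → I → I) (f : ℕ → L1) (p : ℕ) (x : I) : ℝ :=
  ∑ j ∈ Finset.range p, iterOp T j (p - j) (f j) x

theorem measurable_pushSum (f : ℕ → L1) (p : ℕ) : Measurable (pushSum T f p) :=
  Finset.measurable_fun_sum _ fun _ _ => (Lp.stronglyMeasurable _).measurable

/-- Dual form of `G_{p+1} = P_{p+1}(f_p + G_p)`: the new summand `j = p` enters through one
application of the operator. -/
theorem integral_pushSum_succ_mul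
    (hT : ∀ n, 1 ≤ n → Measure.QuasiMeasurePreserving (T n) (volume : Measure I) volume)
    (f : ℕ → L1) (p : ℕ) {W : I → ℝ} (hW : Measurable W) {c : ℝ} (hc : ∀ x, |W x| ≤ c) :
    ∫ x, pushSum T f (p + 1) x * W x = ∫ x, (f p x + pushSum T f p x) * W (T (p + 1) x) := by
  have hTp := hT (p + 1) (by omega)
  have hi : ∀ u : L1, Integrable (fun x => u x * W x) volume := fun u =>
    (L1.integrable_coeFn u).mul_bdd (c := c) hW.aestronglyMeasurable
      (Filter.Eventually.of_forall hc)
  have hiT : ∀ u : L1, Integrable (fun x => u x * W (T (p + 1) x)) volume := fun u =>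
    (L1.integrable_coeFn u).mul_bdd (c := c) (hW.comp hTp.measurable).aestronglyMeasurable
      (Filter.Eventually.of_forall fun x => hc _)
  have hstep : ∀ j ∈ Finset.range (p + 1), ∫ x, iterOp T j (p + 1 - j) (f j) x * W x =
      ∫ x, iterOp T j (p - j) (f j) x * W (T (p + 1) x) := fun j hj => by
    have hj' : j ≤ p := Nat.lt_succ_iff.1 (Finset.mem_range.1 hj)
    have e : iterOp T j (p + 1 - j) (f j) = transferOp (T (p + 1)) (iterOp T j (p - j) (f j)) := by
      rw [Nat.sub_add_comm hj']
      change transferOp (T (j + (p - j) + 1)) _ = _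
      rw [Nat.add_sub_cancel' hj']
    rw [e, integral_transferOp_mul hTp _ hW hc]
  have e0 : iterOp T p (p - p) (f p) = f p := by
    rw [Nat.sub_self]
    rfl
  unfold pushSum
  simp only [Finset.sum_mul, add_mul]
  rw [integral_finsetSum _ fun j _ => hi _, Finset.sum_congr rfl hstep,
    integral_add (hiT _) (integrable_finsetSum _ fun j _ => hiT _),
    integral_finsetSum _ fun j _ => hiT _, Finset.sum_range_succ, e0, add_comm]

theorem abs_pushSum_le {f : ℕ → L1} {θ K A : ℝ} (h0 : 0 ≤ θ) (h1 : θ < 1) (hK : 0 < K)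
    (hdec : ∀ a l : ℕ, 1 ≤ l → IsBV (iterOp T a l (f a)) ∧
      bvNorm (iterOp T a l (f a)) ≤ K * θ ^ l * bvNorm (f a))
    (hA : ∀ a, bvNorm (f a) ≤ A) (p : ℕ) :
    ∀ᵐ x, |pushSum T f p x| ≤ K * A * (1 / (1 - θ)) := by
  have hA0 : 0 ≤ A := (bvNorm_nonneg _).trans (hA 0)
  have h : ∀ᵐ x, ∀ j ∈ Finset.range p,
      |iterOp T j (p - j) (f j) x| ≤ K * A * θ ^ (p - j) := by
    rw [Filter.eventually_all_finset]
    intro j hj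
    -- Since `j < p`, at least one operator acts on each summand, as the decay estimate requires.
    obtain ⟨hb, hn⟩ := hdec j (p - j) (Nat.sub_pos_of_lt (Finset.mem_range.1 hj))
    filter_upwards [hb.abs_le_bvNorm] with x hx
    refine hx.trans (hn.trans ?_)
    calc
      K * θ ^ (p - j) * bvNorm (f j) ≤ K * θ ^ (p - j) * A := by
        gcongr
        exact hA j
      _ = _ := by ring
  filter_upwards [h] with x hx
  calc
    _ ≤ ∑ j ∈ Finset.range p, |iterOp T j (p - j) (f j) x| := Finset.abs_sum_le_sum_abs _ _
    _ ≤ ∑ j ∈ Finset.range p, K * A * θ ^ (p - j) := Finset.sum_le_sum hx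
    _ = K * A * ∑ j ∈ Finset.range p, θ ^ (p - j) := (Finset.mul_sum _ _ _).symm
    _ ≤ _ := by
      gcongr
      exact sum_pow_sub_le h0 h1 p

/-- The martingale decomposition of an additive functional with observables `φ k` such that the
functions `φ k * P_1^k 𝟙` have uniformly bounded pushed forward sums. -/
theorem exists_isReverseMartingaleDecomp
    (hT : ∀ n, 1 ≤ n → Measure.QuasiMeasurePreserving (T n) (volume : Measure I) volume)
    {φ : ℕ → I → ℝ} (hφm : ∀ k, Measurable (φ k)) (hφ1 : ∀ k x, |φ k x| ≤ 1)
    (hφ0 : ∀ k, ∫ x, φ k (seqComp T k x) = 0) {f : ℕ → L1}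
    (hf : ∀ k, f k =ᵐ[volume] fun x => φ k x * density T k x) {δ R : ℝ} (hδ : 0 < δ) (hR : 0 ≤ R)
    (hdens : ∀ k, ∀ᵐ x, δ ≤ density T k x) (hG : ∀ p, ∀ᵐ x, |pushSum T f p x| ≤ R) :
    ∃ ψ, IsReverseMartingaleDecomp T (1 + 2 * (R / δ)) φ ψ := by
  have hR' : 0 ≤ R / δ := by positivity
  -- The quotient is bounded by `R / δ` only almost everywhere. Truncation makes the bound hold at
  -- every point and changes `ψ` only on a null set.
  let ψ : ℕ → I → ℝ := fun p x =>
    max (-(R / δ)) (min (R / δ) (pushSum T f p x / density T p x))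
  have hψm : ∀ p, Measurable (ψ p) := fun p => measurable_const.max (measurable_const.min
    ((measurable_pushSum f p).div (Lp.stronglyMeasurable _).measurable))
  have hψb : ∀ p x, |ψ p x| ≤ R / δ := fun p x => abs_le.2
    ⟨le_max_left _ _, max_le (by linarith) (min_le_left _ _)⟩
  have hψG : ∀ p, ∀ᵐ x, density T p x * ψ p x = pushSum T f p x := fun p => by
    filter_upwards [hdens p, hG p] with x hx hx'
    have hpos : 0 < density T p x := hδ.trans_le hx
    have hq : |pushSum T f p x / density T p x| ≤ R / δ := by
      rw [abs_div, abs_of_pos hpos]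
      gcongr
    obtain ⟨hq1, hq2⟩ := abs_le.1 hq
    simp only [ψ]
    rw [min_eq_right hq2, max_eq_right hq1]
    field_simp
  refine ⟨ψ, hφm, hψm, fun k x => (hψb k x).trans (by linarith), fun k x y => ?_, ?_, ?_, hφ0⟩
  · have h1 := abs_le.1 (hφ1 k x)
    have h2 := abs_le.1 (hψb k x)
    have h3 := abs_le.1 (hψb (k + 1) y)
    rw [abs_le]
    constructor <;> linarith
  · intro k W c hW hc
    have hTk := hT (k + 1) (by omega)
    calc
      _ = ∫ x, density T k x * ((φ k x + ψ k x) * W (T (k + 1) x)) :=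
        (integral_density_mul hT k (((hφm k).add (hψm k)).mul (hW.comp hTk.measurable))
          (c := (1 + R / δ) * c) fun x => by
            rw [Pi.mul_apply, abs_mul]
            exact mul_le_mul ((abs_add_le _ _).trans (add_le_add (hφ1 k x) (hψb k x))) (hc _)
              (abs_nonneg _) (by positivity)).symm
      _ = ∫ x, (f k x + pushSum T f k x) * W (T (k + 1) x) := by
        refine integral_congr_ae ?_
        filter_upwards [hf k, hψG k] with x hx hx'
        rw [hx, ← hx']
        ring
      _ = ∫ x, pushSum T f (k + 1) x * W x := (integral_pushSum_succ_mul hT f k hW hc).symm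
      _ = ∫ x, density T (k + 1) x * (ψ (k + 1) x * W x) := by
        refine integral_congr_ae ?_
        filter_upwards [hψG (k + 1)] with x hx
        rw [← hx]
        ring
      _ = _ := integral_density_mul hT (k + 1) ((hψm (k + 1)).mul hW) (c := R / δ * c)
        fun x => by
          rw [abs_mul]
          exact mul_le_mul (hψb _ _) (hc _) (abs_nonneg _) hR'
  · intro x
    simp [ψ, pushSum, hR']

/-- The centred indicator functions have martingale decompositions bounded uniformly in the
threshold. -/
theorem exists_isReverseMartingaleDecomp_centeredIndicator (h𝒞 : NonsingularClass 𝒞) {r : ℕ}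
    (hD : CondD r 𝒞) (hDec : CondDec 𝒞) (hT𝒞 : ∀ n, 1 ≤ n → T n ∈ 𝒞) (hMin : CondMin T) :
    ∃ D : ℝ, 0 < D ∧ ∀ t : I, ∃ ψ, IsReverseMartingaleDecomp T D (centeredIndicator T t) ψ := by
  have hT : ∀ n, 1 ≤ n → Measure.QuasiMeasurePreserving (T n) (volume : Measure I) volume :=
    fun n hn => h𝒞 _ (hT𝒞 n hn)
  have hTm : ∀ n, 1 ≤ n → Measurable (T n) := fun n hn => (hT n hn).measurable
  obtain ⟨δ, hδ, hdens⟩ := hMin.exists_le_density hT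
  obtain ⟨B, hB, hbv⟩ := hD.exists_bvNorm_density_le hT𝒞 fun k =>
    norm_density hT ((hdens k).mono fun x hx => hδ.le.trans hx)
  obtain ⟨θ, K, h0, h1, hK, hiter⟩ := hDec.exists_iterOp_bound hT𝒞 hT
  have hθ : 0 < 1 - θ := by linarith
  -- The 1 bounds `φ k`, and each of the two `ψ` terms is at most `R / δ` with `R = K * (3 * B) / (1
  -- - θ)`.
  refine ⟨1 + 2 * (K * (3 * B) * (1 / (1 - θ)) / δ), by positivity, fun t => ?_⟩
  have hint : ∀ k, Integrable (fun x => centeredIndicator T t k x * density T k x) volume :=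
    fun k => (L1.integrable_coeFn _).bdd_mul (c := 1)
      (measurable_centeredIndicator t k).aestronglyMeasurable
      (Filter.Eventually.of_forall fun x => abs_centeredIndicator_le hTm k t x)
  have hf : ∀ k, (hint k).toL1 _ =ᵐ[volume] fun x => centeredIndicator T t k x * density T k x :=
    fun k => Integrable.coeFn_toL1 _
  have hfbv : ∀ k, IsBV ((hint k).toL1 _) ∧ bvNorm ((hint k).toL1 _) ≤ 3 * B := fun k => by
    obtain ⟨h2, h3⟩ := (hbv k).1.antitone_mul (antitone_centeredIndicator k t)
      (abs_centeredIndicator_le hTm k t) (hf k)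
    exact ⟨h2, h3.trans (mul_le_mul_of_nonneg_left (hbv k).2 zero_le_three)⟩
  have hf0 : ∀ k, ∫ x, (hint k).toL1 _ x = 0 := fun k => by
    rw [integral_congr_ae (hf k), ← integral_centeredIndicator hTm k t,
      ← integral_density_mul hT k (measurable_centeredIndicator t k)
        (abs_centeredIndicator_le hTm k t)]
    exact integral_congr_ae (Filter.Eventually.of_forall fun x => mul_comm _ _)
  exact exists_isReverseMartingaleDecomp hT (measurable_centeredIndicator t)
    (fun k x => abs_centeredIndicator_le hTm k t x) (fun k => integral_centeredIndicator hTm k t)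
    hf hδ (by positivity) hdens
    (abs_pushSum_le h0 h1 hK (fun a l hl => hiter a l hl _ (hfbv a).1 (hf0 a))
      fun a => (hfbv a).2)

end Decomposition

end SeqDyn

theorem mainTheorem8
    (𝒞 : Set (unitInterval → unitInterval)) (h𝒞 : SeqDyn.NonsingularClass 𝒞)
    (r : ℕ) (hD : SeqDyn.CondD r 𝒞) (hDec : SeqDyn.CondDec 𝒞)
    (T : ℕ → unitInterval → unitInterval) (hT : ∀ n : ℕ, 1 ≤ n → T n ∈ 𝒞)
    (hMin : SeqDyn.CondMin T) :
    ∃ C : ℝ, 0 < C ∧ ∀ t : ℝ, 0 < t → ∀ n : ℕ, 1 ≤ n →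
      (volume : Measure unitInterval).real
          {x | SeqDyn.kantorovich (SeqDyn.empiricalMeasure T n x) (SeqDyn.meanMeasure T n)
            > t / Real.sqrt n}
        ≤ 2 * Real.exp (-(C * t ^ 2)) := by
  obtain ⟨D, hD0, h⟩ :=
    SeqDyn.exists_isReverseMartingaleDecomp_centeredIndicator h𝒞 hD hDec hT hMin
  exact ⟨1 / (4 * D ^ 2), by positivity, fun t ht n hn =>
    SeqDyn.kantorovich_tail_le (fun n hn => (h𝒞 _ (hT n hn)).measurable) hD0 h ht hn⟩
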